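/- For $p,q$ let $$Q_{pq}(t)=t^{10}+(2q^2+p^2)(3q^2-2p^2)\,t^8+(q^8+10p^2q^6+4p^4q^4-14p^6q^2+p^8)\,t^6$$ $$-\,p^2q^2(q^8-14p^2q^6+4p^4q^4+10p^6q^2+p^8)\,t^4-p^6q^6(q^2+2p^2)(3p^2-2q^2)\,t^2-q^{10}p^{10}.$$ Let $B\in\{1,2,\dots,9\}$, let $\tilde p>0$ be an integer and let $\tilde q$ be a real number (in particular, $\tilde q$ may be an integer) with $\tilde q\geqslant 3600\sqrt[3]{|\tilde p|}$. Let $Q_{\tilde p\tilde q}(t)$ be the polynomial obtained from $Q_{pq}(t)$ by the substitution $p=B\tilde q^3-\tilde p$, $q=\tilde q$. Then the equation $Q_{\tilde p\tilde q}(t)=0$ has exactly five complex roots $t$ that obey the condition $$t>0\ \text{ if } t \text{ is real},\qquad \operatorname{Im} t>0\ \text{ if } t \text{ is not real},$$ and all five are simple. Exactly three of them, $t_1,t_2,t_3$, are real and positive (the other two, $t_4,t_5$, are not real). They lie respectively in the following three open intervals, which are pairwise disjoint: $$a<t_1<a+\frac{10\tilde p}{B^2\tilde q^3},\qquad a=B^2\tilde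 q^6+2B\tilde q^4-2B\tilde p\tilde q^3-2\tilde q^2-2\tilde p\tilde q+\tilde p^2+\frac5B-\frac{20}{B^2\tilde q^2};$$ $$b-\frac{10\tilde p}{B^2\tilde q^3}<t_2<b,\qquad b=B^2\tilde q^6-2B\tilde q^4-2B\tilde p\tilde q^3-2\tilde q^2+2\tilde p\tilde q+\tilde p^2-\frac5B-\frac{20}{B^2\tilde q^2};$$ $$c<t_3<c+\frac{32\tilde p}{B^2\tilde q^3},\qquad c=B\tilde q^4-\tilde p\tilde q+\frac{16}{B}.$$ -/

import Mathlib

open Polynomial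

/-- The tenth degree cuboid characteristic polynomial `Q_{p q}(t)`, with `t = X`. -/
noncomputable def cuboidPoly {R : Type*} [CommRing R] (p q : R) : R[X] :=
  X ^ 10
    + C ((2 * q ^ 2 + p ^ 2) * (3 * q ^ 2 - 2 * p ^ 2)) * X ^ 8
    + C (q ^ 8 + 10 * p ^ 2 * q ^ 6 + 4 * p ^ 4 * q ^ 4 - 14 * p ^ 6 * q ^ 2 + p ^ 8) * X ^ 6
    - C (p ^ 2 * q ^ 2 *
        (q ^ 8 - 14 * p ^ 2 * q ^ 6 + 4 * p ^ 4 * q ^ 4 + 10 * p ^ 6 * q ^ 2 + p ^ 8)) * X ^ 4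
    - C (p ^ 6 * q ^ 6 * (q ^ 2 + 2 * p ^ 2) * (3 * p ^ 2 - 2 * q ^ 2)) * X ^ 2
    - C (q ^ 10 * p ^ 10)

/-- The polynomial in the transformed parameters `p' = B q ^ 3 - p`, `q' = q`: it is obtained by
substituting `p = B q' ^ 3 - p'`, `q = q'` into the cuboid characteristic polynomial. It is
considered over `ℂ`. -/
noncomputable def transformedPoly (B : ℕ) (p' : ℤ) (q' : ℝ) : ℂ[X] :=
  cuboidPoly ((B : ℂ) * (q' : ℂ) ^ 3 - (p' : ℂ)) (q' : ℂ)

/-- The condition selecting one root from each pair of opposite roots: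
`t > 0` if `t` is real, `Im t > 0` if `t` is not real. -/
def SelectedHalf (t : ℂ) : Prop :=
  (t.im = 0 → 0 < t.re) ∧ (t.im ≠ 0 → 0 < t.im)

/-- The site of the root `t₁` for `p' > 0`. -/
def siteOne (B : ℕ) (p' : ℤ) (q' : ℝ) : Set ℝ :=
  Set.Ioo
    ((B : ℝ) ^ 2 * q' ^ 6 + 2 * B * q' ^ 4 - 2 * B * p' * q' ^ 3 - 2 * q' ^ 2 - 2 * p' * q'
      + (p' : ℝ) ^ 2 + 5 / B - 20 / ((B : ℝ) ^ 2 * q' ^ 2))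
    ((B : ℝ) ^ 2 * q' ^ 6 + 2 * B * q' ^ 4 - 2 * B * p' * q' ^ 3 - 2 * q' ^ 2 - 2 * p' * q'
      + (p' : ℝ) ^ 2 + 5 / B - 20 / ((B : ℝ) ^ 2 * q' ^ 2)
      + 10 * p' / ((B : ℝ) ^ 2 * q' ^ 3))

/-- The site of the root `t₂` for `p' > 0`. -/
def siteTwo (B : ℕ) (p' : ℤ) (q' : ℝ) : Set ℝ :=
  Set.Ioo
    ((B : ℝ) ^ 2 * q' ^ 6 - 2 * B * q' ^ 4 - 2 * B * p' * q' ^ 3 - 2 * q' ^ 2 + 2 * p' * q'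
      + (p' : ℝ) ^ 2 - 5 / B - 20 / ((B : ℝ) ^ 2 * q' ^ 2)
      - 10 * p' / ((B : ℝ) ^ 2 * q' ^ 3))
    ((B : ℝ) ^ 2 * q' ^ 6 - 2 * B * q' ^ 4 - 2 * B * p' * q' ^ 3 - 2 * q' ^ 2 + 2 * p' * q'
      + (p' : ℝ) ^ 2 - 5 / B - 20 / ((B : ℝ) ^ 2 * q' ^ 2))

/-- The site of the root `t₃` for `p' > 0`. -/
def siteThree (B : ℕ) (p' : ℤ) (q' : ℝ) : Set ℝ :=
  Set.Ioo
    ((B : ℝ) * q' ^ 4 - p' * q' + 16 / B)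
    ((B : ℝ) * q' ^ 4 - p' * q' + 16 / B + 32 * p' / ((B : ℝ) ^ 2 * q' ^ 3))

/-! Homogeneity (`eval_cuboidPoly_scale`) reduces the problem to `p = 1` and a small parameter `y =
q / p`, at most `10⁻⁶` under the hypotheses. At `y = 0` the polynomial is `t ^ 6 * (t ^ 2 - 1) ^ 2`.
For small `y > 0` the double root `1` splits into two real roots, and the sixfold root `0` yields a
real pair of size `y` and two imaginary pairs of size `y ^ 2`. Sign changes at truncated power
series locate the real roots (`exists_positive_roots`); sign changes along the imaginary axis give
the others (`exists_imaginary_roots`).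

These five roots and their opposites already exhaust degree 10, so there are no other roots and all
are simple (`selected_roots_eq`). It remains to rewrite the series in `q / p` in terms of `q` and
`p' = B * q ^ 3 - p` (`expansion_bounds`). -/

/-! ### Symmetries and homogeneity of the polynomial. -/

theorem eval_cuboidPoly {R : Type*} [CommRing R] (p q t : R) :
    (cuboidPoly p q).eval t = t ^ 10
      + (2 * q ^ 2 + p ^ 2) * (3 * q ^ 2 - 2 * p ^ 2) * t ^ 8
      + (q ^ 8 + 10 * p ^ 2 * q ^ 6 + 4 * p ^ 4 * q ^ 4 - 14 * p ^ 6 * q ^ 2 + p ^ 8) * t ^ 6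
      - p ^ 2 * q ^ 2 *
        (q ^ 8 - 14 * p ^ 2 * q ^ 6 + 4 * p ^ 4 * q ^ 4 + 10 * p ^ 6 * q ^ 2 + p ^ 8) * t ^ 4
      - p ^ 6 * q ^ 6 * (q ^ 2 + 2 * p ^ 2) * (3 * p ^ 2 - 2 * q ^ 2) * t ^ 2
      - q ^ 10 * p ^ 10 := by
  simp only [cuboidPoly, eval_add, eval_sub, eval_mul, eval_pow, eval_X, eval_C]

theorem eval_cuboidPoly_neg {R : Type*} [CommRing R] (p q t : R) :
    (cuboidPoly p q).eval (-t) = (cuboidPoly p q).eval t := by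
  simp only [eval_cuboidPoly]
  ring

theorem eval_cuboidPoly_neg_right {R : Type*} [CommRing R] (p q t : R) :
    (cuboidPoly p (-q)).eval t = (cuboidPoly p q).eval t := by
  simp only [eval_cuboidPoly]
  ring

/-- The cuboid polynomial is homogeneous of degree `20` when `t` has weight `2`. -/
theorem eval_cuboidPoly_scale {R : Type*} [CommRing R] (p y t : R) :
    (cuboidPoly p (p * y)).eval (p ^ 2 * t) = p ^ 20 * (cuboidPoly 1 y).eval t := by
  simp only [eval_cuboidPoly]
  ring

theorem eval_cuboidPoly_ofReal (p q t : ℝ) :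
    (cuboidPoly (p : ℂ) (q : ℂ)).eval (t : ℂ) = (((cuboidPoly p q).eval t : ℝ) : ℂ) := by
  simp only [eval_cuboidPoly]
  push_cast
  ring

theorem natDegree_cuboidPoly {R : Type*} [CommRing R] [Nontrivial R] (p q : R) :
    (cuboidPoly p q).natDegree = 10 := by
  unfold cuboidPoly
  compute_degree!

/-! ### Signs at truncated series. -/

/-- Horner evaluation of the polynomial with the given integer coefficients, constant term
first. -/
def horner (y : ℝ) : List ℤ → ℝ
  | [] => 0
  | a :: l => a + y * horner y l

/-- A bound for the absolute value of `horner y l` when `|y| ≤ 10⁻⁶`. -/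
def magnitude : List ℤ → ℚ
  | [] => 0
  | a :: l => |(a : ℚ)| + 1 / 1000000 * magnitude l

theorem abs_horner_le {y : ℝ} (hy : |y| ≤ 1 / 1000000) (l : List ℤ) :
    |horner y l| ≤ (magnitude l : ℝ) := by
  induction l with
  | nil => simp [horner, magnitude]
  | cons a l ih =>
    simp only [horner, magnitude]
    push_cast
    refine (abs_add_le _ _).trans (add_le_add le_rfl ?_)
    rw [abs_mul]
    exact mul_le_mul hy ih (abs_nonneg _) (by norm_num)

/-- Near zero, a polynomial with an even order of vanishing has the sign of its lowest
coefficient. -/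
theorem pow_mul_horner_pos {y : ℝ} {n : ℕ} (hn : Even n) (hy0 : y ≠ 0) (hy : |y| ≤ 1 / 1000000)
    (l : List ℤ) (a : ℤ) (h : magnitude l < 2 * a) (ha : l.head? = some a := by rfl) :
    0 < y ^ n * horner y l := by
  refine mul_pos (hn.pow_pos hy0) ?_
  obtain ⟨l, rfl⟩ : ∃ l', l = a :: l' := by
    cases l with
    | nil => simp at ha
    | cons b l => exact ⟨l, by simpa using ha⟩
  have hpos : 0 ≤ magnitude l := by exact_mod_cast (abs_nonneg _).trans (abs_horner_le hy l)
  simp only [magnitude] at h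
  -- The head contributes `|a|` to the magnitude, so a bound by `2 * a` forces `a > 0` and makes the
  -- tail smaller than `a`.
  have ha0 : (0 : ℚ) < a := by
    by_contra hc
    have := abs_nonneg (a : ℚ)
    linarith
  rw [abs_of_pos ha0] at h
  have h1 : (1 / 1000000 * (magnitude l : ℝ)) < a := by
    have : ((1 / 1000000 * magnitude l : ℚ) : ℝ) < ((a : ℚ) : ℝ) :=
      Rat.cast_lt.2 (by linarith)
    push_cast at this
    exact this
  have h2 := abs_horner_le hy l
  have h3 : |y * horner y l| ≤ 1 / 1000000 * magnitude l := by
    rw [abs_mul]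
    exact mul_le_mul hy h2 (abs_nonneg _) (by norm_num)
  have h4 := neg_abs_le (y * horner y l)
  simp only [horner]
  linarith

/-- With `c * y ^ 5` added to this truncation, the value is `(16 * c - 1228) * y ^ 6` to leading
order. The true next coefficient is therefore `307 / 4`, and `c = 0` and `c = 100` bracket it.
Negative `y` is allowed in order to cover the other root near `1`. -/
theorem eval_at_outer_lower_neg {y : ℝ} (hy0 : y ≠ 0) (hy : |y| ≤ 1 / 1000000) :
    (cuboidPoly 1 y).eval (1 + 2 * y - 2 * y ^ 2 + 5 * y ^ 3 - 20 * y ^ 4) < 0 := by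
  have key := pow_mul_horner_pos (n := 6) (by decide) hy0 hy
    [1228, 11976, 35460, 32140, -59944, -905572, -2651661, -921092, 649829, 31715350, 92891182,
     -44560724, 106046235, -804210628, -1860215219, 3128461640, -7644772395, 23131511450,
     6631354075, -54365223000, 197930809000, -580638931250, 775459856250, -810712487500,
     -182906815625, 4174874625000, -10622743250000, 21464920000000, -35575880000000,
     46219200000000, -54121600000000, 52480000000000, -39040000000000, 25600000000000,
     -10240000000000]
    1228 (by norm_num [magnitude])
  rw [← neg_pos]
  convert key using 1
  simp only [horner, eval_cuboidPoly]
  ring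

theorem eval_at_outer_upper_pos {y : ℝ} (hy0 : y ≠ 0) (hy : |y| ≤ 1 / 1000000) :
    0 < (cuboidPoly 1 y).eval (1 + 2 * y - 2 * y ^ 2 + 5 * y ^ 3 - 20 * y ^ 4 + 100 * y ^ 5) := by
  have key := pow_mul_horner_pos (n := 6) (by decide) hy0 hy
    [372, 10424, 75740, 198260, 159944, -84428, 2937261, 31075892, 72815371, 24406250,
     -54272382, 196989724, 6265738965, 11169883028, -3410504581, 847405960, -59012244805,
     909887908950, 582146955925, -668378910000, 1950272931000, -18104315058750,
     115550847218750, -108953755387500, 182875941815625, -165766335875000, -1446272473625000,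
     10179749907500000, -23326050838750000, 56198315000000000, -121516739400000000,
     171755576000000000, 37003685000000000, -691522600000000000, 2849283240000000000,
     -8679052000000000000, 20859170000000000000, -40737600000000000000, 75024000000000000000,
     -123464000000000000000, 172850000000000000000, -206000000000000000000,
     230000000000000000000, -200000000000000000000, 100000000000000000000]
    372 (by norm_num [magnitude])
  convert key using 1
  simp only [horner, eval_cuboidPoly]
  ring

/-- With `c * y ^ 5` added, the leading term is `(2 * c - 128) * y ^ 10`; the true coefficient `64`
lies between `0` and `100`. -/
theorem eval_at_inner_lower_neg {y : ℝ} (hy0 : y ≠ 0) (hy : |y| ≤ 1 / 1000000) :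
    (cuboidPoly 1 y).eval (y + 16 * y ^ 3) < 0 := by
  have key := pow_mul_horner_pos (n := 10) (by decide) hy0 hy
    [128, 0, 19232, 0, 835456, 0, 16673760, 0, 173471488, 0, 905379840, 0, 758251520, 0,
     -24467472384, 0, -201880240128, 0, -712964571136, 0, -1099511627776]
    128 (by norm_num [magnitude])
  rw [← neg_pos]
  convert key using 1
  simp only [horner, eval_cuboidPoly]
  ring

theorem eval_at_inner_upper_pos {y : ℝ} (hy0 : y ≠ 0) (hy : |y| ≤ 1 / 1000000) :
    0 < (cuboidPoly 1 y).eval (y + 16 * y ^ 3 + 100 * y ^ 5) := by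
  have key := pow_mul_horner_pos (n := 10) (by decide) hy0 hy
    [72, 0, -5632, 0, -577856, 0, -22364160, 0, -531344088, 0, -8874661440, 0, -109939819120,
     0, -1017159279616, 0, -6570650550272, 0, -18764212414464, 0, 193592613080576, 0,
     3766034505216000, 0, 37250058259200000, 0, 267378222720000000, 0, 1498206696000000000, 0,
     6674059520000000000, 0, 23495360000000000000, 0, 63612000000000000000, 0,
     125200000000000000000, 0, 160000000000000000000, 0, 100000000000000000000]
    72 (by norm_num [magnitude])
  convert key using 1
  simp only [horner, eval_cuboidPoly]
  ring

/-! ### Existence of the roots for `p = 1`. -/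

theorem exists_eval_cuboidPoly_eq_zero {y a b : ℝ} (hab : a ≤ b)
    (h : (cuboidPoly 1 y).eval a < 0 ∧ 0 < (cuboidPoly 1 y).eval b ∨
      0 < (cuboidPoly 1 y).eval a ∧ (cuboidPoly 1 y).eval b < 0) :
    ∃ t ∈ Set.Ioo a b, (cuboidPoly 1 y).eval t = 0 := by
  have hc : ContinuousOn (fun t => (cuboidPoly 1 y).eval t) (Set.Icc a b) :=
    (cuboidPoly 1 y).continuous.continuousOn
  rcases h with h | h
  · exact intermediate_value_Ioo hab hc h
  · exact intermediate_value_Ioo' hab hc ⟨h.2, h.1⟩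

/-- The values of the cuboid polynomial with `p = 1` on the imaginary axis. -/
theorem eval_cuboidPoly_I_mul (y x : ℝ) :
    (cuboidPoly 1 (y : ℂ)).eval (Complex.I * x) = ((-x ^ 10
      + (2 * y ^ 2 + 1) * (3 * y ^ 2 - 2) * x ^ 8
      - (y ^ 8 + 10 * y ^ 6 + 4 * y ^ 4 - 14 * y ^ 2 + 1) * x ^ 6
      - y ^ 2 * (y ^ 8 - 14 * y ^ 6 + 4 * y ^ 4 + 10 * y ^ 2 + 1) * x ^ 4
      + y ^ 6 * (y ^ 2 + 2) * (3 - 2 * y ^ 2) * x ^ 2 - y ^ 10 : ℝ) : ℂ) := by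
  have h2 : Complex.I ^ 2 = -1 := Complex.I_sq
  have h4 : Complex.I ^ 4 = 1 := Complex.I_pow_four
  have h6 : Complex.I ^ 6 = -1 := by rw [show 6 = 2 * 3 from rfl, pow_mul, h2]; norm_num
  have h8 : Complex.I ^ 8 = 1 := by rw [show 8 = 2 * 4 from rfl, pow_mul, h2]; norm_num
  have h10 : Complex.I ^ 10 = -1 := by rw [show 10 = 2 * 5 from rfl, pow_mul, h2]; norm_num
  simp only [eval_cuboidPoly, mul_pow, h2, h4, h6, h8, h10]
  push_cast
  ring

/-- For small `y` the cuboid polynomial has two pairs of opposite imaginary roots. -/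
theorem exists_imaginary_roots {y : ℝ} (hy0 : 0 < y) (hy : y ≤ 1 / 1000000) :
    ∃ x₄ x₅ : ℝ, 0 < x₅ ∧ x₅ < x₄ ∧
      (cuboidPoly 1 (y : ℂ)).eval (Complex.I * x₄) = 0 ∧
      (cuboidPoly 1 (y : ℂ)).eval (Complex.I * x₅) = 0 := by
  set f : ℝ → ℝ := fun x => -x ^ 10
      + (2 * y ^ 2 + 1) * (3 * y ^ 2 - 2) * x ^ 8
      - (y ^ 8 + 10 * y ^ 6 + 4 * y ^ 4 - 14 * y ^ 2 + 1) * x ^ 6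
      - y ^ 2 * (y ^ 8 - 14 * y ^ 6 + 4 * y ^ 4 + 10 * y ^ 2 + 1) * x ^ 4
      + y ^ 6 * (y ^ 2 + 2) * (3 - 2 * y ^ 2) * x ^ 2 - y ^ 10 with hf
  have hc : Continuous f := by fun_prop
  have hy' : |y| ≤ 1 / 1000000 := by rwa [abs_of_pos hy0]
  -- At `x = s * y ^ 2` the leading term is `-(s ^ 4 - 6 * s ^ 2 + 1) * y ^ 10`, with positive zeros
  -- `s = √2 ± 1`; the points `s = 0, 1, 3` separate them.
  have f0 : f 0 < 0 := by
    have : f 0 = -y ^ 10 := by simp only [hf]; ring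
    rw [this]
    linarith [pow_pos hy0 10]
  have f1 : 0 < f (y ^ 2) := by
    have key := pow_mul_horner_pos (n := 10) (by decide) hy0.ne' hy'
      [4, 0, -12, 0, 8, 0, 8, 0, -12, 0, 4] 4 (by norm_num [magnitude])
    convert key using 1
    simp only [horner, hf]
    ring
  have f3 : f (3 * y ^ 2) < 0 := by
    have key := pow_mul_horner_pos (n := 10) (by decide) hy0.ne' hy'
      [28, 0, 1548, 0, -9864, 0, 14904, 0, 13932, 0, 20412] 28 (by norm_num [magnitude])
    rw [← neg_pos]
    convert key using 1
    simp only [horner, hf]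
    ring
  have hy2 : 0 < y ^ 2 := by positivity
  obtain ⟨x₅, hx₅, h5⟩ := intermediate_value_Ioo hy2.le hc.continuousOn ⟨f0, f1⟩
  obtain ⟨x₄, hx₄, h4⟩ := intermediate_value_Ioo' (by linarith : y ^ 2 ≤ 3 * y ^ 2)
    hc.continuousOn ⟨f3, f1⟩
  refine ⟨x₄, x₅, hx₅.1, hx₅.2.trans hx₄.1, ?_, ?_⟩
  · rw [eval_cuboidPoly_I_mul, Complex.ofReal_eq_zero]
    exact h4
  · rw [eval_cuboidPoly_I_mul, Complex.ofReal_eq_zero]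
    exact h5

/-- For small `y` the cuboid polynomial has three positive roots, with known expansions. -/
theorem exists_positive_roots {y : ℝ} (hy0 : 0 < y) (hy : y ≤ 1 / 1000000) :
    ∃ t₁ t₂ t₃ : ℝ,
      (cuboidPoly 1 y).eval t₁ = 0 ∧ (cuboidPoly 1 y).eval t₂ = 0 ∧
      (cuboidPoly 1 y).eval t₃ = 0 ∧
      t₁ ∈ Set.Ioo (1 + 2 * y - 2 * y ^ 2 + 5 * y ^ 3 - 20 * y ^ 4)
        (1 + 2 * y - 2 * y ^ 2 + 5 * y ^ 3 - 20 * y ^ 4 + 100 * y ^ 5) ∧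
      t₂ ∈ Set.Ioo (1 - 2 * y - 2 * y ^ 2 - 5 * y ^ 3 - 20 * y ^ 4 - 100 * y ^ 5)
        (1 - 2 * y - 2 * y ^ 2 - 5 * y ^ 3 - 20 * y ^ 4) ∧
      t₃ ∈ Set.Ioo (y + 16 * y ^ 3) (y + 16 * y ^ 3 + 100 * y ^ 5) := by
  have hy' : |y| ≤ 1 / 1000000 := by rwa [abs_of_pos hy0]
  have hy'' : |-y| ≤ 1 / 1000000 := by rwa [abs_neg]
  have h5 : 0 < y ^ 5 := by positivity
  -- The polynomial is even in `y`, so the series at `-y` describes the second root near `1`. Since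
  -- `(-y) ^ 5 < 0`, the endpoints trade places.
  have hl := eval_at_outer_lower_neg (neg_ne_zero.2 hy0.ne') hy''
  have hu := eval_at_outer_upper_pos (neg_ne_zero.2 hy0.ne') hy''
  rw [eval_cuboidPoly_neg_right] at hl hu
  obtain ⟨t₁, h₁, e₁⟩ := exists_eval_cuboidPoly_eq_zero (by linarith)
    (Or.inl ⟨eval_at_outer_lower_neg hy0.ne' hy', eval_at_outer_upper_pos hy0.ne' hy'⟩)
  obtain ⟨t₂, h₂, e₂⟩ := exists_eval_cuboidPoly_eq_zero
    (by linarith [show (-y) ^ 5 = -y ^ 5 by ring]) (Or.inr ⟨hu, hl⟩)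
  obtain ⟨t₃, h₃, e₃⟩ := exists_eval_cuboidPoly_eq_zero (by linarith)
    (Or.inl ⟨eval_at_inner_lower_neg hy0.ne' hy', eval_at_inner_upper_pos hy0.ne' hy'⟩)
  refine ⟨t₁, t₂, t₃, e₁, e₂, e₃, h₁, ?_, h₃⟩
  constructor
  · convert h₂.1 using 1; ring
  · convert h₂.2 using 1; ring

/-! ### Counting roots of an even polynomial. -/

theorem SelectedHalf.not_neg {t : ℂ} (h : SelectedHalf t) : ¬ SelectedHalf (-t) := by
  intro h'
  simp only [SelectedHalf, Complex.neg_im, Complex.neg_re, neg_eq_zero] at h h'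
  by_cases ht : t.im = 0
  · linarith [h.1 ht, h'.1 ht]
  · linarith [h.2 ht, h'.2 (by simpa using ht)]

/-- An even polynomial of degree `2n` with `n` selected roots has no other selected roots, and
these are simple. -/
theorem selected_roots_eq {P : ℂ[X]} {S : Finset ℂ} (hdeg : P.natDegree = 2 * S.card)
    (hP : P ≠ 0) (heven : ∀ t, P.eval (-t) = P.eval t)
    (hroot : ∀ t ∈ S, P.IsRoot t) (hsel : ∀ t ∈ S, SelectedHalf t) :
    {t : ℂ | P.IsRoot t ∧ SelectedHalf t} = (S : Set ℂ) ∧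
      ∀ t ∈ S, P.rootMultiplicity t = 1 := by
  classical
  obtain ⟨N, hN⟩ : ∃ N : Finset ℂ, N = S.image Neg.neg := ⟨_, rfl⟩
  have hdisj : Disjoint S N := by
    rw [Finset.disjoint_left]
    intro t ht htN
    obtain ⟨u, hu, rfl⟩ := Finset.mem_image.1 (hN ▸ htN)
    exact (hsel u hu).not_neg (hsel _ ht)
  have hcard : (S ∪ N).card = 2 * S.card := by
    rw [Finset.card_union_of_disjoint hdisj, hN, Finset.card_image_of_injective _ neg_injective]
    ring
  have hsub : (S ∪ N).val ≤ P.roots := by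
    rw [Finset.val_le_iff_val_subset]
    intro t ht
    rw [mem_roots hP]
    rcases Finset.mem_union.1 ht with h | h
    · exact hroot t h
    · obtain ⟨u, hu, rfl⟩ := Finset.mem_image.1 (hN ▸ h)
      exact (heven u).trans (hroot u hu)
  -- Equality as multisets gives both exhaustiveness and simplicity.
  have heq : (S ∪ N).val = P.roots := by
    refine Multiset.eq_of_le_of_card_le hsub ?_
    rw [Finset.card_val, hcard, ← hdeg]
    exact card_roots' P
  refine ⟨?_, ?_⟩
  · ext t
    rw [Finset.mem_coe]
    refine ⟨fun ⟨h, hs⟩ => ?_, fun h => ⟨hroot t h, hsel t h⟩⟩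
    rw [← mem_roots hP, ← heq, Finset.mem_val, Finset.mem_union] at h
    rcases h with h | h
    · exact h
    · obtain ⟨u, hu, rfl⟩ := Finset.mem_image.1 (hN ▸ h)
      exact absurd hs (hsel u hu).not_neg
  · intro t ht
    rw [← count_roots, ← heq]
    exact Multiset.count_eq_one_of_mem (S ∪ N).nodup (Finset.mem_union_left _ ht)

/-! ### From powers of `q / p` to powers of `q`. -/

/-- The expansions of the positive roots in powers of `q / p`, compared with those in powers of
`q` after the substitution `p = B q ^ 3 - P`. -/
theorem expansion_bounds {B P q p : ℝ} (hB : 1 ≤ B) (hP : 1 ≤ P) (hq : 3600 ≤ q)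
    (hPq : 3600 ^ 3 * P ≤ q ^ 3) (hp : p = B * q ^ 3 - P) :
    0 < p ∧ 1000000 * q ≤ p ∧
    (∀ τ ∈ Set.Ioo (1 + 2 * (q / p) - 2 * (q / p) ^ 2 + 5 * (q / p) ^ 3 - 20 * (q / p) ^ 4)
        (1 + 2 * (q / p) - 2 * (q / p) ^ 2 + 5 * (q / p) ^ 3 - 20 * (q / p) ^ 4
          + 100 * (q / p) ^ 5),
      p ^ 2 * τ ∈ Set.Ioo (p ^ 2 + 2 * p * q - 2 * q ^ 2 + 5 / B - 20 / (B ^ 2 * q ^ 2))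
        (p ^ 2 + 2 * p * q - 2 * q ^ 2 + 5 / B - 20 / (B ^ 2 * q ^ 2)
          + 10 * P / (B ^ 2 * q ^ 3))) ∧
    (∀ τ ∈ Set.Ioo (1 - 2 * (q / p) - 2 * (q / p) ^ 2 - 5 * (q / p) ^ 3 - 20 * (q / p) ^ 4
          - 100 * (q / p) ^ 5)
        (1 - 2 * (q / p) - 2 * (q / p) ^ 2 - 5 * (q / p) ^ 3 - 20 * (q / p) ^ 4),
      p ^ 2 * τ ∈ Set.Ioo (p ^ 2 - 2 * p * q - 2 * q ^ 2 - 5 / B - 20 / (B ^ 2 * q ^ 2)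
          - 10 * P / (B ^ 2 * q ^ 3))
        (p ^ 2 - 2 * p * q - 2 * q ^ 2 - 5 / B - 20 / (B ^ 2 * q ^ 2))) ∧
    (∀ τ ∈ Set.Ioo (q / p + 16 * (q / p) ^ 3) (q / p + 16 * (q / p) ^ 3 + 100 * (q / p) ^ 5),
      p ^ 2 * τ ∈ Set.Ioo (p * q + 16 / B) (p * q + 16 / B + 32 * P / (B ^ 2 * q ^ 3))) ∧
    p ^ 2 - 2 * p * q - 2 * q ^ 2 - 5 / B - 20 / (B ^ 2 * q ^ 2) ≤
      p ^ 2 + 2 * p * q - 2 * q ^ 2 + 5 / B - 20 / (B ^ 2 * q ^ 2) ∧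
    p * q + 16 / B + 32 * P / (B ^ 2 * q ^ 3) ≤
      p ^ 2 - 2 * p * q - 2 * q ^ 2 - 5 / B - 20 / (B ^ 2 * q ^ 2)
        - 10 * P / (B ^ 2 * q ^ 3) := by
  have hB0 : 0 < B := by linarith
  have hq0 : 0 < q := by linarith
  have hP0 : 0 < P := by linarith
  have hq3 : 0 < q ^ 3 := by positivity
  have hBq : q ^ 3 ≤ B * q ^ 3 := le_mul_of_one_le_left hq3.le hB
  have hqq : 3600 ^ 2 * q ≤ q ^ 3 := by
    have : 3600 ^ 2 ≤ q ^ 2 := pow_le_pow_left₀ (by norm_num) hq 2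
    calc 3600 ^ 2 * q ≤ q ^ 2 * q := by gcongr
      _ = q ^ 3 := by ring
  have hpq : 1000000 * q ≤ p := by linarith
  have hp0 : 0 < p := by linarith
  -- Here `r = 1 / (1 - d)` measures the error of replacing `p` by `B * q ^ 3`, and `w` is the size
  -- of the fourth-order term. After multiplication by `B`, the site widths are `10 * d` and `32 *
  -- d`, twice the main errors `5 * (r - 1)` and `16 * (r - 1)`; the slack absorbs the rest.
  obtain ⟨d, hd⟩ : ∃ d, d = P / (B * q ^ 3) := ⟨_, rfl⟩
  obtain ⟨w, hw⟩ : ∃ w, w = 1 / (B * q ^ 2) := ⟨_, rfl⟩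
  obtain ⟨r, hr⟩ : ∃ r, r = B * q ^ 3 / p := ⟨_, rfl⟩
  have hd0 : 0 < d := by rw [hd]; positivity
  have hw0 : 0 < w := by rw [hw]; positivity
  have hr1 : r - 1 = d * r := by rw [hr, hd]; field_simp; linarith
  have hr0 : 1 ≤ r := by rw [hr, one_le_div hp0]; linarith
  have hr2 : r ≤ 1001 / 1000 := by rw [hr, div_le_iff₀ hp0]; linarith
  have hd1 : d ≤ 1 := by rw [hd, div_le_one (by positivity)]; linarith
  have hw1 : w ≤ 1 / 1000 := by
    rw [hw]
    apply one_div_le_one_div_of_le (by norm_num)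
    nlinarith [le_mul_of_one_le_left (sq_nonneg q) hB]
  -- This lets the fifth-order remainder be absorbed into `d`; it uses `P ≥ 1`.
  have hwd : w ^ 2 ≤ d / 3600 := by
    rw [hw, hd, div_pow, div_div, div_le_div_iff₀ (by positivity) (by positivity)]
    have : 3600 ≤ P * B * q := by
      have : 1 ≤ P * B := one_le_mul_of_one_le_of_one_le hP hB
      nlinarith
    calc 1 ^ 2 * (B * q ^ 3 * 3600) = B * q ^ 3 * 3600 := by ring
      _ ≤ B * q ^ 3 * (P * B * q) := by gcongr
      _ = P * (B * q ^ 2) ^ 2 := by ring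
  have hdr : d * r ≤ 1001 / 1000 * d := by nlinarith
  have hdr0 : 0 < d * r := by positivity
  have hr3 : r ^ 3 * w ^ 2 ≤ d / 1000 := by
    have : r ^ 3 ≤ (1001 / 1000) ^ 3 := pow_le_pow_left₀ (by linarith) hr2 3
    calc r ^ 3 * w ^ 2 ≤ (1001 / 1000) ^ 3 * (d / 3600) :=
          mul_le_mul this hwd (sq_nonneg w) (by norm_num)
      _ ≤ d / 1000 := by linarith
  have hrw : w * r ^ 2 - w = w * (r + 1) * (d * r) := by rw [← hr1]; ring
  have hrw0 : 0 < w * (r + 1) * (d * r) := by positivity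
  have hrw1 : w * (r + 1) * (d * r) ≤ 3 / 1000 * (d * r) := by
    apply mul_le_mul_of_nonneg_right _ hdr0.le
    nlinarith
  have e1 : p ^ 2 * (q / p) = p * q := by field_simp
  have e2 : p ^ 2 * (q / p) ^ 2 = q ^ 2 := by field_simp
  have e3 : p ^ 2 * (q / p) ^ 3 = r / B := by rw [hr]; field_simp
  have e4 : p ^ 2 * (q / p) ^ 4 = w * r ^ 2 / B := by rw [hr, hw]; field_simp
  have e5 : p ^ 2 * (q / p) ^ 5 = r ^ 3 * w ^ 2 / B := by rw [hr, hw]; field_simp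
  have f1 : 20 / (B ^ 2 * q ^ 2) = 20 * w / B := by rw [hw]; field_simp
  have f2 : ∀ k : ℝ, k * P / (B ^ 2 * q ^ 3) = k * d / B := by
    intro k; rw [hd]; field_simp
  have hp2 : 0 < p ^ 2 := by positivity
  have div_lt : ∀ {x z : ℝ}, x < z → x / B < z / B := fun h => div_lt_div_of_pos_right h hB0
  rw [f1, f2, f2]
  refine ⟨hp0, hpq, ?_, ?_, ?_, ?_, ?_⟩
  · intro τ hτ
    have h1 := mul_lt_mul_of_pos_left hτ.1 hp2
    have h2 := mul_lt_mul_of_pos_left hτ.2 hp2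
    have h3 := div_lt (show 5 - 20 * w < 5 * r - 20 * (w * r ^ 2) by linarith)
    have h4 := div_lt (show 5 * r - 20 * (w * r ^ 2) + 100 * (r ^ 3 * w ^ 2)
      < 5 - 20 * w + 10 * d by linarith)
    constructor
    · linear_combination h1 + h3 - 2 * e1 + 2 * e2 - 5 * e3 + 20 * e4
    · linear_combination h2 + h4 + 2 * e1 - 2 * e2 + 5 * e3 - 20 * e4 + 100 * e5
  · intro τ hτ
    have h1 := mul_lt_mul_of_pos_left hτ.1 hp2
    have h2 := mul_lt_mul_of_pos_left hτ.2 hp2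
    have h3 := div_lt (show -5 * r - 20 * (w * r ^ 2) < -5 - 20 * w by linarith)
    have h4 := div_lt (show -5 - 20 * w - 10 * d <
      -5 * r - 20 * (w * r ^ 2) - 100 * (r ^ 3 * w ^ 2) by linarith)
    constructor
    · linear_combination h1 + h4 + 2 * e1 + 2 * e2 + 5 * e3 + 20 * e4 + 100 * e5
    · linear_combination h2 + h3 - 2 * e1 - 2 * e2 - 5 * e3 - 20 * e4
  · intro τ hτ
    have h1 := mul_lt_mul_of_pos_left hτ.1 hp2
    have h2 := mul_lt_mul_of_pos_left hτ.2 hp2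
    have h3 := div_lt (show 16 < 16 * r by linarith)
    have h4 := div_lt (show 16 * r + 100 * (r ^ 3 * w ^ 2) < 16 + 32 * d by linarith)
    constructor
    · linear_combination h1 + h3 - e1 - 16 * e3
    · linear_combination h2 + h4 + e1 + 16 * e3 + 100 * e5
  · have : 0 < 5 / B := by positivity
    have : 0 < p * q := by positivity
    linarith
  -- All terms with denominators together stay bounded, while `p ^ 2` dominates `p * q` and `q ^ 2`.
  · have h1 : (21 + 20 * w + 42 * d) / B ≤ 21 + 20 * w + 42 * d :=
      div_le_self (by positivity) hB
    have h2 : (21 + 20 * w + 42 * d) / B =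
        5 / B + 16 / B + 20 * w / B + 10 * d / B + 32 * d / B := by ring
    have h3 : 1000000 * q * p ≤ p ^ 2 := by rw [sq]; gcongr
    have h4 : 1000000 * q * q ≤ q * p := by nlinarith
    have h5 : 3600 * 3600 ≤ q * q := by gcongr
    linarith

theorem cast_transform_bounds {P : ℤ} (hP : 0 < P) {q : ℝ}
    (hq : 3600 * |(P : ℝ)| ^ (1 / 3 : ℝ) ≤ q) :
    1 ≤ (P : ℝ) ∧ 3600 ≤ q ∧ 3600 ^ 3 * (P : ℝ) ≤ q ^ 3 := by
  have hP1 : 1 ≤ (P : ℝ) := by exact_mod_cast hP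
  rw [abs_of_nonneg (by linarith)] at hq
  have h1 : 1 ≤ (P : ℝ) ^ (1 / 3 : ℝ) := Real.one_le_rpow hP1 (by norm_num)
  refine ⟨hP1, by linarith, ?_⟩
  have h3 : ((P : ℝ) ^ (1 / 3 : ℝ)) ^ 3 = P := by
    rw [← Real.rpow_natCast, ← Real.rpow_mul (by linarith)]
    norm_num
  calc 3600 ^ 3 * (P : ℝ) = (3600 * (P : ℝ) ^ (1 / 3 : ℝ)) ^ 3 := by rw [mul_pow, h3]
    _ ≤ q ^ 3 := pow_le_pow_left₀ (by positivity) hq 3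

/-! ### Assembly of the theorem. -/

theorem theorem6p2 (B : ℕ) (hB1 : 1 ≤ B) (hB9 : B ≤ 9) (p' : ℤ) (hp : 0 < p')
    (q' : ℝ) (hq : 3600 * |(p' : ℝ)| ^ (1 / 3 : ℝ) ≤ q') :
    Disjoint (siteOne B p' q') (siteTwo B p' q') ∧
    Disjoint (siteOne B p' q') (siteThree B p' q') ∧
    Disjoint (siteTwo B p' q') (siteThree B p' q') ∧
    ∃ (t₁ t₂ t₃ : ℝ) (t₄ t₅ : ℂ),
      0 < t₁ ∧ t₁ ∈ siteOne B p' q' ∧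
      0 < t₂ ∧ t₂ ∈ siteTwo B p' q' ∧
      0 < t₃ ∧ t₃ ∈ siteThree B p' q' ∧
      t₄.im ≠ 0 ∧ t₅.im ≠ 0 ∧ t₄ ≠ t₅ ∧
      {t : ℂ | (transformedPoly B p' q').IsRoot t ∧ SelectedHalf t} =
        {(t₁ : ℂ), (t₂ : ℂ), (t₃ : ℂ), t₄, t₅} ∧
      (transformedPoly B p' q').rootMultiplicity (t₁ : ℂ) = 1 ∧
      (transformedPoly B p' q').rootMultiplicity (t₂ : ℂ) = 1 ∧
      (transformedPoly B p' q').rootMultiplicity (t₃ : ℂ) = 1 ∧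
      (transformedPoly B p' q').rootMultiplicity t₄ = 1 ∧
      (transformedPoly B p' q').rootMultiplicity t₅ = 1 := by
  obtain ⟨hP1, hq1, hPq⟩ := cast_transform_bounds hp hq
  have hB : (1 : ℝ) ≤ B := by exact_mod_cast hB1
  obtain ⟨p, hpdef⟩ : ∃ p : ℝ, p = B * q' ^ 3 - p' := ⟨_, rfl⟩
  obtain ⟨hp0, hpq, m₁, m₂, m₃, hba, hcb⟩ := expansion_bounds hB hP1 hq1 hPq hpdef
  have hq0 : 0 < q' := by linarith
  -- In terms of `p`, the polynomial parts of the endpoints collapse to `p ^ 2 ± 2 * p * q' - 2 * q'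
  -- ^ 2` and `p * q'`.
  have s₁ : siteOne B p' q' =
      Set.Ioo (p ^ 2 + 2 * p * q' - 2 * q' ^ 2 + 5 / B - 20 / ((B : ℝ) ^ 2 * q' ^ 2))
        (p ^ 2 + 2 * p * q' - 2 * q' ^ 2 + 5 / B - 20 / ((B : ℝ) ^ 2 * q' ^ 2)
          + 10 * p' / ((B : ℝ) ^ 2 * q' ^ 3)) := by
    rw [siteOne, hpdef]
    congr 1 <;> ring
  have s₂ : siteTwo B p' q' =
      Set.Ioo (p ^ 2 - 2 * p * q' - 2 * q' ^ 2 - 5 / B - 20 / ((B : ℝ) ^ 2 * q' ^ 2)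
          - 10 * p' / ((B : ℝ) ^ 2 * q' ^ 3))
        (p ^ 2 - 2 * p * q' - 2 * q' ^ 2 - 5 / B - 20 / ((B : ℝ) ^ 2 * q' ^ 2)) := by
    rw [siteTwo, hpdef]
    congr 1 <;> ring
  have s₃ : siteThree B p' q' = Set.Ioo (p * q' + 16 / B)
      (p * q' + 16 / B + 32 * p' / ((B : ℝ) ^ 2 * q' ^ 3)) := by
    rw [siteThree, hpdef]
    congr 1 <;> ring
  have hP : transformedPoly B p' q' = cuboidPoly (p : ℂ) (q' : ℂ) := by
    rw [transformedPoly, hpdef]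
    push_cast
    rfl
  rw [s₁, s₂, s₃, hP]
  have hd : 0 ≤ 10 * p' / ((B : ℝ) ^ 2 * q' ^ 3) := by positivity
  obtain ⟨y, hy⟩ : ∃ y, y = q' / p := ⟨_, rfl⟩
  have hy0 : 0 < y := by rw [hy]; positivity
  have hy1 : y ≤ 1 / 1000000 := by rw [hy, div_le_iff₀ hp0]; linarith
  have hpy : q' = p * y := by rw [hy]; field_simp
  obtain ⟨τ₁, τ₂, τ₃, e₁, e₂, e₃, i₁, i₂, i₃⟩ := exists_positive_roots hy0 hy1
  obtain ⟨x₄, x₅, hx₅, hx, e₄, e₅⟩ := exists_imaginary_roots hy0 hy1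
  rw [hy] at i₁ i₂ i₃
  have j₁ := m₁ τ₁ i₁
  have j₂ := m₂ τ₂ i₂
  have j₃ := m₃ τ₃ i₃
  have l₃ : 0 < p ^ 2 * τ₃ := lt_trans (by positivity) j₃.1
  have l₂₃ : p ^ 2 * τ₃ < p ^ 2 * τ₂ := by linarith [j₃.2, j₂.1]
  have l₁₂ : p ^ 2 * τ₂ < p ^ 2 * τ₁ := by linarith [j₂.2, j₁.1]
  have hp2 : 0 < p ^ 2 := by positivity
  have l₅ : 0 < p ^ 2 * x₅ := mul_pos hp2 hx₅
  have l₄₅ : p ^ 2 * x₅ < p ^ 2 * x₄ := mul_lt_mul_of_pos_left hx hp2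
  have real_root : ∀ τ : ℝ, (cuboidPoly 1 y).eval τ = 0 →
      (cuboidPoly (p : ℂ) (q' : ℂ)).IsRoot ((p ^ 2 * τ : ℝ) : ℂ) := by
    intro τ h
    rw [IsRoot, eval_cuboidPoly_ofReal, hpy, eval_cuboidPoly_scale, h, mul_zero,
      Complex.ofReal_zero]
  have imag_root : ∀ x : ℝ, (cuboidPoly 1 (y : ℂ)).eval (Complex.I * x) = 0 →
      (cuboidPoly (p : ℂ) (q' : ℂ)).IsRoot (Complex.I * (p ^ 2 * x : ℝ)) := by
    intro x h
    have : Complex.I * ((p ^ 2 * x : ℝ) : ℂ) = (p : ℂ) ^ 2 * (Complex.I * x) := by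
      push_cast
      ring
    rw [IsRoot, this, hpy, Complex.ofReal_mul, eval_cuboidPoly_scale, h, mul_zero]
  have real_selected : ∀ t : ℝ, 0 < t → SelectedHalf (t : ℂ) := fun t ht => by
    simp [SelectedHalf, ht]
  have imag_selected : ∀ x : ℝ, 0 < x → SelectedHalf (Complex.I * x) := fun x hx => by
    simp [SelectedHalf, hx, hx.ne']
  have ne_imag : ∀ t x : ℝ, 0 < t → (t : ℂ) ≠ Complex.I * x := fun t x ht h => by
    have := congrArg Complex.re h
    simp at this
    exact ht.ne' this
  obtain ⟨S, hS⟩ : ∃ S : Finset ℂ, S = {((p ^ 2 * τ₁ : ℝ) : ℂ), ((p ^ 2 * τ₂ : ℝ) : ℂ),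
    ((p ^ 2 * τ₃ : ℝ) : ℂ), Complex.I * (p ^ 2 * x₄ : ℝ), Complex.I * (p ^ 2 * x₅ : ℝ)} :=
    ⟨_, rfl⟩
  have h45 : Complex.I * ((p ^ 2 * x₄ : ℝ) : ℂ) ≠ Complex.I * ((p ^ 2 * x₅ : ℝ) : ℂ) := by
    intro h
    exact l₄₅.ne' (Complex.ofReal_injective (mul_left_cancel₀ Complex.I_ne_zero h))
  have hcard : S.card = 5 := by
    have n₁₂ := Complex.ofReal_injective.ne l₁₂.ne'
    have n₁₃ := Complex.ofReal_injective.ne (l₂₃.trans l₁₂).ne'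
    have n₂₃ := Complex.ofReal_injective.ne l₂₃.ne'
    rw [hS, Finset.card_insert_of_notMem, Finset.card_insert_of_notMem,
      Finset.card_insert_of_notMem, Finset.card_pair h45]
    · simp only [Finset.mem_insert, Finset.mem_singleton, not_or]
      exact ⟨ne_imag _ _ l₃, ne_imag _ _ l₃⟩
    · simp only [Finset.mem_insert, Finset.mem_singleton, not_or]
      exact ⟨n₂₃, ne_imag _ _ (l₃.trans l₂₃), ne_imag _ _ (l₃.trans l₂₃)⟩
    · simp only [Finset.mem_insert, Finset.mem_singleton, not_or]
      have := (l₃.trans l₂₃).trans l₁₂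
      exact ⟨n₁₂, n₁₃, ne_imag _ _ this, ne_imag _ _ this⟩
  have hdeg := natDegree_cuboidPoly (p : ℂ) (q' : ℂ)
  have hne : cuboidPoly (p : ℂ) (q' : ℂ) ≠ 0 := by
    intro h
    simp [h] at hdeg
  obtain ⟨hroots, hmult⟩ := selected_roots_eq (S := S) (by rw [hdeg, hcard]) hne
    (eval_cuboidPoly_neg _ _)
    (by
      rw [hS]
      simp only [Finset.forall_mem_insert, Finset.mem_singleton, forall_eq]
      exact ⟨real_root _ e₁, real_root _ e₂, real_root _ e₃, imag_root _ e₄, imag_root _ e₅⟩)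
    (by
      rw [hS]
      simp only [Finset.forall_mem_insert, Finset.mem_singleton, forall_eq]
      exact ⟨real_selected _ ((l₃.trans l₂₃).trans l₁₂), real_selected _ (l₃.trans l₂₃),
        real_selected _ l₃, imag_selected _ (l₅.trans l₄₅), imag_selected _ l₅⟩)
  refine ⟨?_, ?_, ?_, p ^ 2 * τ₁, p ^ 2 * τ₂, p ^ 2 * τ₃, Complex.I * (p ^ 2 * x₄ : ℝ),
    Complex.I * (p ^ 2 * x₅ : ℝ), (l₃.trans l₂₃).trans l₁₂, j₁, l₃.trans l₂₃, j₂, l₃, j₃,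
    ?_, ?_, h45, ?_, ?_⟩
  · rw [Set.disjoint_left]
    exact fun t h h' => absurd (h.1.trans h'.2) (by linarith)
  · rw [Set.disjoint_left]
    exact fun t h h' => absurd (h.1.trans h'.2) (by linarith)
  · rw [Set.disjoint_left]
    exact fun t h h' => absurd (h.1.trans h'.2) (by linarith)
  · rw [Complex.I_mul_im, Complex.ofReal_re]
    exact (l₅.trans l₄₅).ne'
  · rw [Complex.I_mul_im, Complex.ofReal_re]
    exact l₅.ne'
  · rw [hroots, hS]
    simp only [Finset.coe_insert, Finset.coe_singleton]
  · rw [hS] at hmult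
    simpa only [Finset.forall_mem_insert, Finset.mem_singleton, forall_eq] using hmult
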